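/- By a graph we mean a finite simple undirected graph. An AR-labeling of a graph $G=(V,E)$ is an injective map $f:E\to\{1,2,3,\dots\}$ such that at every vertex $v$ the $2^{\deg v}$ subsets of the set of edges incident on $v$ have pairwise distinct label sums. $G$ is an AR-graph if it has an AR-labeling $f:E\to\{1,2,\dots,m\}$, where $m=|E|$. For $r\ge 1$ let $T_{r,2}$ be the perfect binary tree of depth $r$ (every interior node has two children and every leaf has depth $r$), and for $n\ge 1$ let the generalized glued binary tree $GT^{(n)}_{r,2}$ be the graph obtained from $n$ disjoint copies of $T_{r,2}$ by identifying, for each leaf of $T_{r,2}$, its $n$ copies with one another. Theorem. For all integers $r\ge 1$ and $1\le n\le 4$, the generalized glued binary tree $GT^{(n)}_{r,2}$ is an AR-graph. -/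

import Mathlib

/-- `v` is an AR-vertex of `G` under the edge labeling `f`: distinct sets of edges incident on `v`
have distinct label sums (the empty set, with sum `0`, is one of the `2 ^ k` sets). -/
def IsARVertex {V : Type*} {G : SimpleGraph V} (f : G.edgeSet → ℕ) (v : V) : Prop :=
  ∀ S T : Finset G.edgeSet, (∀ e ∈ S, v ∈ (e : Sym2 V)) → (∀ e ∈ T, v ∈ (e : Sym2 V)) →
    ∑ e ∈ S, f e = ∑ e ∈ T, f e → S = T

/-- An AR-labeling of `G`: an injective labeling of the edges by positive integers under which
every vertex is an AR-vertex. -/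
def IsARLabeling {V : Type*} (G : SimpleGraph V) (f : G.edgeSet → ℕ) : Prop :=
  Function.Injective f ∧ (∀ e, 0 < f e) ∧ ∀ v, IsARVertex f v

/-- A finite graph is an AR-graph if it has an AR-labeling with labels in `{1, …, m}`, where `m` is
its number of edges. -/
def IsARGraph {V : Type*} [Finite V] (G : SimpleGraph V) : Prop :=
  ∃ f : G.edgeSet → ℕ, IsARLabeling G f ∧ ∀ e, f e ∈ Set.Icc 1 G.edgeSet.ncard

/-- The nodes of the perfect `t`-ary tree of depth `r`: words of length at most `r` in `t` letters.
The empty word is the root, the children of `w` are the words `a :: w`, the depth of a node is its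
length, and the leaves are the words of length `r`. -/
abbrev TreeNode (r t : ℕ) : Type := {w : List (Fin t) // w.length ≤ r}

/-- The perfect `t`-ary tree of depth `r`: every node is joined to its children. -/
def perfectTree (r t : ℕ) : SimpleGraph (TreeNode r t) where
  Adj u v := (∃ a, v.1 = a :: u.1) ∨ (∃ a, u.1 = a :: v.1)
  symm := ⟨fun _ _ h => h.symm⟩
  loopless := ⟨by
    intro u h
    rcases h with ⟨a, h⟩ | ⟨a, h⟩ <;> simpa using congrArg List.length h⟩

/-- The vertices of the generalized glued tree made from `n` copies of the perfect `t`-ary tree of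
depth `r`: the inner (non-leaf) nodes of each copy, and one quasi-leaf for each leaf of the tree. -/
abbrev GluedNode (n r t : ℕ) : Type :=
  (Fin n × {w : List (Fin t) // w.length < r}) ⊕ {w : List (Fin t) // w.length = r}

/-- The identification map: the vertex of the glued tree that comes from the node `u` of the `i`-th
copy of the perfect tree. -/
def glue {n r t : ℕ} (i : Fin n) (u : TreeNode r t) : GluedNode n r t :=
  if h : u.1.length < r then Sum.inl (i, ⟨u.1, h⟩)
  else Sum.inr ⟨u.1, le_antisymm u.2 (not_lt.mp h)⟩

/-- Two nodes are identified exactly if they are equal nodes of the same copy, or are the same leaf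
in two copies. -/
theorem glue_eq_glue_iff {n r t : ℕ} (i j : Fin n) (u v : TreeNode r t) :
    glue i u = glue j v ↔ u = v ∧ (i = j ∨ u.1.length = r) := by
  obtain ⟨u, hu⟩ := u
  obtain ⟨v, hv⟩ := v
  unfold glue
  by_cases h : u.length < r <;> by_cases h' : v.length < r
  · simp only [h, h', dite_true, Sum.inl.injEq, Prod.mk.injEq, Subtype.mk.injEq, h.ne, or_false]
    tauto
  · simp only [h, h', dite_true, dite_false, reduceCtorEq, Subtype.mk.injEq, false_iff]
    rintro ⟨rfl, -⟩
    exact h' h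
  · simp only [h, h', dite_true, dite_false, reduceCtorEq, Subtype.mk.injEq, false_iff]
    rintro ⟨rfl, -⟩
    exact h h'
  · have : u.length = r := le_antisymm hu (not_lt.mp h)
    rw [dif_neg h, dif_neg h']
    simp only [Sum.inr.injEq, Subtype.mk.injEq, this, or_true, and_true]

/-- The generalized glued `t`-ary tree obtained from `n` copies of the perfect `t`-ary tree of depth
`r` by identifying corresponding leaves: the image of the disjoint union of the copies. -/
def gluedTree (n r t : ℕ) : SimpleGraph (GluedNode n r t) where
  Adj x y := ∃ (i : Fin n) (u v : TreeNode r t),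
    (perfectTree r t).Adj u v ∧ glue i u = x ∧ glue i v = y
  symm := ⟨by
    rintro x y ⟨i, u, v, h, hx, hy⟩
    exact ⟨i, v, u, h.symm, hy, hx⟩⟩
  loopless := ⟨by
    rintro x ⟨i, u, v, h, hx, hy⟩
    exact h.ne ((glue_eq_glue_iff i i u v).1 (hx.trans hy.symm)).1⟩

instance finite_gluedNode (n r t : ℕ) : Finite (GluedNode n r t) := by
  have h₁ : Finite {w : List (Fin t) // w.length < r} := List.finite_length_lt (Fin t) r
  have h₂ : Finite {w : List (Fin t) // w.length = r} := List.finite_length_eq (Fin t) r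
  infer_instance

/-! The labels `1, …, 2n` go to the edges at the `n` roots. For each word `u`, in breadth-first
order, the next `4n` labels go to the edges below the children of `u`, in all copies together. An
inner vertex has its parent edge and two child edges with larger labels from one block. It fails
only if the child labels differ by the parent label. That difference is below `4n`, so only finitely
many parents near the roots matter. A quasi-leaf has one edge per copy, all in one block. For `n ≥
2` these labels exceed `2n` and lie within `2n` consecutive values, so no label is a sum of others.
Hence a finite table suffices for each `n ≤ 4`, independently of `r`. -/

/-- Distinct sets of indices have distinct sums. -/
def DistinctSubsetSums {ι : Type*} (c : ι → ℕ) : Prop :=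
  ∀ A B : Finset ι, ∑ i ∈ A, c i = ∑ i ∈ B, c i → A = B

theorem DistinctSubsetSums.injective {ι : Type*} {c : ι → ℕ} (h : DistinctSubsetSums c) :
    Function.Injective c := by
  intro i j hij
  exact Finset.singleton_injective (h {i} {j} (by simpa using hij))

theorem distinctSubsetSums_iff_bits {k : ℕ} {c : Fin k → ℕ} :
    DistinctSubsetSums c ↔ ∀ p q : Fin k → Bool,
      (∑ i, if p i then c i else 0) = (∑ i, if q i then c i else 0) → p = q := by
  constructor
  · intro h p q hpq
    have := h (Finset.univ.filter fun i => p i) (Finset.univ.filter fun i => q i)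
      (by simpa [Finset.sum_filter] using hpq)
    funext i
    have hi := Finset.ext_iff.1 this i
    simp only [Finset.mem_filter, Finset.mem_univ, true_and] at hi
    exact Bool.eq_iff_iff.2 hi
  · intro h A B hAB
    have := h (fun i => decide (i ∈ A)) (fun i => decide (i ∈ B)) (by simpa using hAB)
    ext i
    simpa using congrFun this i

theorem distinctSubsetSums_one {c : Fin 1 → ℕ} (h : 0 < c 0) : DistinctSubsetSums c := by
  rw [distinctSubsetSums_iff_bits]
  intro p q hpq
  simp only [Fin.sum_univ_one] at hpq
  funext i
  fin_cases i
  show p 0 = q 0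
  generalize p 0 = a, q 0 = b at *
  cases a <;> cases b <;> simp at hpq ⊢ <;> omega

theorem distinctSubsetSums_two {c : Fin 2 → ℕ} (h₀ : 0 < c 0) (h₁ : 0 < c 1) (h : c 0 ≠ c 1) :
    DistinctSubsetSums c := by
  rw [distinctSubsetSums_iff_bits]
  intro p q hpq
  simp only [Fin.sum_univ_two] at hpq
  have key : p 0 = q 0 ∧ p 1 = q 1 := by
    generalize p 0 = a, q 0 = b, p 1 = a', q 1 = b' at *
    cases a <;> cases b <;> cases a' <;> cases b' <;> simp at hpq ⊢ <;> omega
  funext i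
  fin_cases i
  exacts [key.1, key.2]

theorem distinctSubsetSums_three {c : Fin 3 → ℕ} (h₀ : 0 < c 0) (h₁ : 0 < c 1) (h₂ : 0 < c 2)
    (h₀₁ : c 0 ≠ c 1) (h₀₂ : c 0 ≠ c 2) (h₁₂ : c 1 ≠ c 2)
    (k₀ : c 1 + c 2 ≠ c 0) (k₁ : c 0 + c 2 ≠ c 1) (k₂ : c 0 + c 1 ≠ c 2) :
    DistinctSubsetSums c := by
  rw [distinctSubsetSums_iff_bits]
  intro p q hpq
  simp only [Fin.sum_univ_three] at hpq
  have key : p 0 = q 0 ∧ p 1 = q 1 ∧ p 2 = q 2 := by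
    generalize p 0 = a, q 0 = b, p 1 = a', q 1 = b', p 2 = a'', q 2 = b'' at *
    cases a <;> cases b <;> cases a' <;> cases b' <;> cases a'' <;> cases b'' <;>
      simp at hpq ⊢ <;> omega
  funext i
  fin_cases i
  exacts [key.1, key.2.1, key.2.2]

/-- Four labels, each smaller than the sum of any two others, that do not split into two pairs of
equal sums. -/
theorem distinctSubsetSums_four {c : Fin 4 → ℕ} (hlt : ∀ i j k, c i < c j + c k)
    (hinj : Function.Injective c) (k₁ : c 0 + c 1 ≠ c 2 + c 3) (k₂ : c 0 + c 2 ≠ c 1 + c 3)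
    (k₃ : c 0 + c 3 ≠ c 1 + c 2) : DistinctSubsetSums c := by
  have hne : ∀ {i j}, i ≠ j → c i ≠ c j := fun h => hinj.ne h
  have n₁ : c 0 ≠ c 1 := hne (by decide)
  have n₂ : c 0 ≠ c 2 := hne (by decide)
  have n₃ : c 0 ≠ c 3 := hne (by decide)
  have n₄ : c 1 ≠ c 2 := hne (by decide)
  have n₅ : c 1 ≠ c 3 := hne (by decide)
  have n₆ : c 2 ≠ c 3 := hne (by decide)
  have l₀ := And.intro (hlt 0 1 2) (And.intro (hlt 0 1 3) (hlt 0 2 3))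
  have l₁ := And.intro (hlt 1 0 2) (And.intro (hlt 1 0 3) (hlt 1 2 3))
  have l₂ := And.intro (hlt 2 0 1) (And.intro (hlt 2 0 3) (hlt 2 1 3))
  have l₃ := And.intro (hlt 3 0 1) (And.intro (hlt 3 0 2) (hlt 3 1 2))
  rw [distinctSubsetSums_iff_bits]
  intro p q hpq
  simp only [Fin.sum_univ_four] at hpq
  have key : p 0 = q 0 ∧ p 1 = q 1 ∧ p 2 = q 2 ∧ p 3 = q 3 := by
    clear hlt hinj hne
    generalize c 0 = x, c 1 = y, c 2 = z, c 3 = w at *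
    generalize p 0 = a, q 0 = b, p 1 = a', q 1 = b', p 2 = a'', q 2 = b'', p 3 = a₃, q 3 = b₃ at *
    cases a <;> cases b <;> cases a' <;> cases b' <;> cases a'' <;> cases b'' <;>
      cases a₃ <;> cases b₃ <;>
      simp only [if_true, if_false, Bool.false_eq_true, reduceCtorEq, and_true, and_false]
        at hpq ⊢ <;> omega
  funext i
  fin_cases i
  exacts [key.1, key.2.1, key.2.2.1, key.2.2.2]

/-- A vertex is an AR-vertex if its edges are listed by a family whose labels have distinct subset
sums. -/
theorem isARVertex_of_distinctSubsetSums {V ι : Type*} {G : SimpleGraph V} {f : G.edgeSet → ℕ}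
    {v : V} [Fintype ι] (φ : ι → G.edgeSet) (hφ : ∀ e : G.edgeSet, v ∈ (e : Sym2 V) → ∃ i, φ i = e)
    (hc : DistinctSubsetSums fun i => f (φ i)) : IsARVertex f v := by
  classical
  have hinj : Function.Injective φ := Function.Injective.of_comp (f := f) hc.injective
  have himage : ∀ S : Finset G.edgeSet, (∀ e ∈ S, v ∈ (e : Sym2 V)) →
      S = (Finset.univ.filter fun i => φ i ∈ S).image φ := by
    intro S hS
    ext e
    simp only [Finset.mem_image, Finset.mem_filter, Finset.mem_univ, true_and]
    constructor
    · intro he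
      obtain ⟨i, rfl⟩ := hφ e (hS e he)
      exact ⟨i, he, rfl⟩
    · rintro ⟨i, hi, rfl⟩
      exact hi
  intro S T hS hT hST
  rw [himage S hS, himage T hT, Finset.sum_image hinj.injOn, Finset.sum_image hinj.injOn] at hST
  rw [himage S hS, himage T hT, hc _ _ hST]

/-! ### Breadth-first numbering of binary words -/

/-- The position of a binary word in the breadth-first enumeration of all binary words. -/
def heapIndex : List (Fin 2) → ℕ
  | [] => 0
  | a :: u => 2 * heapIndex u + 1 + a

theorem heapIndex_injective : Function.Injective heapIndex := by
  intro u
  induction u with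
  | nil =>
    intro v h
    cases v with
    | nil => rfl
    | cons b v =>
      simp only [heapIndex] at h
      omega
  | cons a u ih =>
    intro v h
    cases v with
    | nil =>
      simp only [heapIndex] at h
      omega
    | cons b v =>
      simp only [heapIndex] at h
      have huv : u = v := ih (by omega)
      subst huv
      have : a = b := Fin.ext (by omega)
      rw [this]

theorem heapIndex_add_two_le (u : List (Fin 2)) : heapIndex u + 2 ≤ 2 ^ (u.length + 1) := by
  induction u with
  | nil => simp [heapIndex]
  | cons a u ih =>
    simp only [heapIndex, List.length_cons, pow_succ _ (u.length + 1)]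
    omega

theorem exists_heapIndex_eq (r k : ℕ) (hk : k + 1 < 2 ^ r) :
    ∃ u : List (Fin 2), u.length < r ∧ heapIndex u = k := by
  induction r generalizing k with
  | zero => simp at hk
  | succ r ih =>
    cases k with
    | zero => exact ⟨[], by simp, rfl⟩
    | succ k =>
      obtain ⟨u, hu, hk'⟩ := ih (k / 2) (by rw [pow_succ] at hk; omega)
      refine ⟨⟨k % 2, by omega⟩ :: u, by simpa using hu, ?_⟩
      simp only [heapIndex, hk']
      omega

theorem two_pow_le_card_words_length_lt (r : ℕ) :
    2 ^ r - 1 ≤ Nat.card {u : List (Fin 2) // u.length < r} := by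
  have : Finite {u : List (Fin 2) // u.length < r} := List.finite_length_lt (Fin 2) r
  have hlt : ∀ u : {u : List (Fin 2) // u.length < r}, heapIndex u.1 < 2 ^ r - 1 := by
    intro u
    have h₁ := heapIndex_add_two_le u.1
    have h₂ : 2 ^ (u.1.length + 1) ≤ 2 ^ r := Nat.pow_le_pow_right (by norm_num) u.2
    omega
  have := Nat.card_le_card_of_surjective
    (fun u : {u : List (Fin 2) // u.length < r} => (⟨heapIndex u.1, hlt u⟩ : Fin (2 ^ r - 1)))
    (by
      rintro ⟨k, hk⟩
      obtain ⟨u, hu, rfl⟩ := exists_heapIndex_eq r k (by omega)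
      exact ⟨⟨u, hu⟩, rfl⟩)
  simpa using this

/-! ### Edges of the glued tree -/

/-- The edge of the `i`-th copy that joins the inner node `u` to its child `a :: u`. -/
def childEdge {n r : ℕ} (x : Fin n × Fin 2 × {u : List (Fin 2) // u.length < r}) :
    (gluedTree n r 2).edgeSet :=
  ⟨s(glue x.1 ⟨x.2.2.1, x.2.2.2.le⟩, glue x.1 ⟨x.2.1 :: x.2.2.1, x.2.2.2⟩),
    ⟨x.1, _, _, Or.inl ⟨x.2.1, rfl⟩, rfl, rfl⟩⟩

theorem childEdge_bijective (n r : ℕ) :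
    Function.Bijective (childEdge (n := n) (r := r)) := by
  constructor
  · rintro ⟨i, a, u, hu⟩ ⟨j, b, v, hv⟩ h
    have h' := congrArg Subtype.val h
    simp only [childEdge, Sym2.eq_iff, glue_eq_glue_iff, Subtype.mk.injEq] at h'
    rcases h' with ⟨⟨rfl, hij⟩, hab, -⟩ | ⟨⟨h₁, -⟩, h₂, -⟩
    · obtain rfl : i = j := hij.resolve_right hu.ne
      simp only [List.cons.injEq, and_true] at hab
      rw [hab]
    · have e₁ := congrArg List.length h₁
      have e₂ := congrArg List.length h₂
      simp only [List.length_cons] at e₁ e₂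
      omega
  · rintro ⟨e, he⟩
    induction e using Sym2.ind with
    | _ x y =>
      obtain ⟨i, ⟨u, hu⟩, ⟨v, hv⟩, huv, hx, hy⟩ := he
      dsimp only at hx hy
      subst hx hy
      rcases huv with ⟨a, h⟩ | ⟨a, h⟩
      · simp only at h
        subst h
        exact ⟨⟨i, a, u, hv⟩, rfl⟩
      · simp only at h
        subst h
        exact ⟨⟨i, a, v, hu⟩, Subtype.ext Sym2.eq_swap⟩

theorem le_ncard_edgeSet_gluedTree (n r : ℕ) :
    n * (2 * (2 ^ r - 1)) ≤ (gluedTree n r 2).edgeSet.ncard := by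
  rw [← Nat.card_coe_set_eq, ← Nat.card_congr (Equiv.ofBijective _ (childEdge_bijective n r)),
    Nat.card_prod, Nat.card_prod]
  simpa using Nat.mul_le_mul_left n (Nat.mul_le_mul_left 2 (two_pow_le_card_words_length_lt r))

theorem inl_mem_childEdge {n r : ℕ} {i : Fin n} {w : {w : List (Fin 2) // w.length < r}}
    {x : Fin n × Fin 2 × {u : List (Fin 2) // u.length < r}}
    (h : Sum.inl (i, w) ∈ (childEdge x : Sym2 (GluedNode n r 2))) :
    x.1 = i ∧ (x.2.2 = w ∨ x.2.1 :: x.2.2.1 = w.1) := by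
  have hw : (Sum.inl (i, w) : GluedNode n r 2) = glue i ⟨w.1, w.2.le⟩ := by simp [glue, w.2]
  rw [hw] at h
  simp only [childEdge, Sym2.mem_iff, glue_eq_glue_iff, Subtype.mk.injEq, w.2.ne, or_false] at h
  rcases h with ⟨h, rfl⟩ | ⟨h, rfl⟩
  · exact ⟨rfl, Or.inl (Subtype.ext h.symm)⟩
  · exact ⟨rfl, Or.inr h.symm⟩

theorem inr_mem_childEdge {n r : ℕ} {w : {w : List (Fin 2) // w.length = r}}
    {x : Fin n × Fin 2 × {u : List (Fin 2) // u.length < r}}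
    (h : Sum.inr w ∈ (childEdge x : Sym2 (GluedNode n r 2))) : x.2.1 :: x.2.2.1 = w.1 := by
  -- A quasi-leaf is the image of its leaf in every copy, so the copy of the edge may be used.
  have hw : (Sum.inr w : GluedNode n r 2) = glue x.1 ⟨w.1, w.2.le⟩ := by simp [glue, w.2]
  rw [hw] at h
  simp only [childEdge, Sym2.mem_iff, glue_eq_glue_iff, Subtype.mk.injEq] at h
  rcases h with ⟨h, -⟩ | ⟨h, -⟩
  · have := x.2.2.2
    rw [← h, w.2] at this
    exact absurd this (lt_irrefl r)
  · exact h.symm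

/-! ### Block labelings from finite tables -/

/-- The label of the edge of the `i`-th copy that joins `u` to `a :: u`: a table `g` for the edges
at the root, and a table `h` repeated in consecutive blocks of `4 * n` labels below. -/
def treeLabel {n : ℕ} (g : Fin n → Fin 2 → ℕ) (h : Fin n → Fin 2 → Fin 2 → ℕ) (i : Fin n)
    (a : Fin 2) : List (Fin 2) → ℕ
  | [] => 1 + g i a
  | b :: u => 1 + 2 * n + 4 * n * heapIndex u + h i a b

/-- The finitely many conditions on the tables `g` and `h` that make `treeLabel g h` an
AR-labeling. -/
structure IsLabelTable {n : ℕ} (g : Fin n → Fin 2 → ℕ) (h : Fin n → Fin 2 → Fin 2 → ℕ) :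
    Prop where
  g_lt : ∀ i a, g i a < 2 * n
  h_lt : ∀ i a b, h i a b < 4 * n
  g_inj : ∀ i a i' a', g i a = g i' a' → i = i' ∧ a = a'
  h_inj : ∀ i a b i' a' b', h i a b = h i' a' b' → i = i' ∧ a = a' ∧ b = b'
  siblings_root : ∀ i b, h i 0 b + (1 + g i b) ≠ h i 1 b ∧ h i 1 b + (1 + g i b) ≠ h i 0 b
  siblings : ∀ i b c, h i 0 b < h i 1 b + (1 + 2 * n) ∧ h i 1 b < h i 0 b + (1 + 2 * n) ∨
    h i 0 b + (1 + 2 * n + h i b c) ≠ h i 1 b ∧ h i 1 b + (1 + 2 * n + h i b c) ≠ h i 0 b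
  leaf_root : ∀ a, DistinctSubsetSums fun i => 1 + g i a
  leaf : ∀ a b k, 2 * n < k → DistinctSubsetSums fun i => k + h i a b

namespace IsLabelTable

variable {n : ℕ} {g : Fin n → Fin 2 → ℕ} {h : Fin n → Fin 2 → Fin 2 → ℕ}

theorem treeLabel_inj (H : IsLabelTable g h) {i i' : Fin n} {a a' : Fin 2} {u u' : List (Fin 2)}
    (he : treeLabel g h i a u = treeLabel g h i' a' u') : i = i' ∧ a = a' ∧ u = u' := by
  rcases u with - | ⟨b, u⟩ <;> rcases u' with - | ⟨b', u'⟩ <;> simp only [treeLabel] at he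
  · obtain ⟨rfl, rfl⟩ := H.g_inj i a i' a' (by omega)
    exact ⟨rfl, rfl, rfl⟩
  · have := H.g_lt i a
    omega
  · have := H.g_lt i' a'
    omega
  · have h₁ := H.h_lt i a b
    have h₂ := H.h_lt i' a' b'
    have he' : h i a b + 4 * n * heapIndex u = h i' a' b' + 4 * n * heapIndex u' := by omega
    have hdiv := congrArg (· / (4 * n)) he'
    simp only [Nat.add_mul_div_left _ _ (Nat.zero_lt_of_lt h₁), Nat.div_eq_of_lt h₁,
      Nat.div_eq_of_lt h₂, zero_add] at hdiv
    rw [hdiv] at he'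
    obtain ⟨rfl, rfl, rfl⟩ := H.h_inj i a b i' a' b' (by omega)
    exact ⟨rfl, rfl, by rw [heapIndex_injective hdiv]⟩

theorem treeLabel_pos (i : Fin n) (a : Fin 2) (u : List (Fin 2)) : 0 < treeLabel g h i a u := by
  rcases u with - | ⟨b, u⟩ <;> simp only [treeLabel] <;> omega

theorem treeLabel_le (H : IsLabelTable g h) (i : Fin n) (a : Fin 2) {u : List (Fin 2)} {r : ℕ}
    (hu : u.length < r) : treeLabel g h i a u ≤ n * (2 * (2 ^ r - 1)) := by
  rcases u with - | ⟨b, u⟩ <;> simp only [treeLabel]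
  · have h₁ := H.g_lt i a
    have h₂ : 1 ≤ 2 ^ r - 1 := by
      have : 2 ^ 1 ≤ 2 ^ r := Nat.pow_le_pow_right (by norm_num) (Nat.succ_le_of_lt hu)
      omega
    nlinarith
  · have h₁ := H.h_lt i a b
    have h₂ := heapIndex_add_two_le u
    have h₃ : 2 ^ (u.length + 2) ≤ 2 ^ r := Nat.pow_le_pow_right (by norm_num) hu
    -- The block of `u` ends at `2n * (2 * heapIndex u + 3)`.
    have h₄ : 2 * heapIndex u + 3 ≤ 2 ^ r - 1 := by
      rw [pow_succ] at h₃
      omega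
    nlinarith [Nat.mul_le_mul_left (2 * n) h₄]

theorem siblings_root_distinctSubsetSums (H : IsLabelTable g h) (i : Fin n) :
    DistinctSubsetSums fun a => treeLabel g h i a [] := by
  refine distinctSubsetSums_two (treeLabel_pos _ _ _) (treeLabel_pos _ _ _) fun he => ?_
  exact absurd (H.treeLabel_inj he).2.1 (by decide)

theorem inner_distinctSubsetSums (H : IsLabelTable g h) (i : Fin n) (b : Fin 2)
    (u : List (Fin 2)) :
    DistinctSubsetSums ![treeLabel g h i 0 (b :: u), treeLabel g h i 1 (b :: u),
      treeLabel g h i b u] := by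
  have hne : treeLabel g h i 0 (b :: u) ≠ treeLabel g h i 1 (b :: u) := fun he =>
    absurd (H.treeLabel_inj he).2.1 (by decide)
  have hlt : ∀ a, treeLabel g h i b u < treeLabel g h i a (b :: u) := by
    intro a
    rcases u with - | ⟨c, v⟩ <;> simp only [treeLabel, heapIndex]
    · have := H.g_lt i b
      omega
    · have := H.h_lt i b c
      nlinarith [Nat.zero_le (n * heapIndex v), Nat.zero_le (n * (c : ℕ))]
  have hsib : treeLabel g h i 0 (b :: u) + treeLabel g h i b u ≠ treeLabel g h i 1 (b :: u) ∧
      treeLabel g h i 1 (b :: u) + treeLabel g h i b u ≠ treeLabel g h i 0 (b :: u) := by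
    rcases u with - | ⟨c, v⟩ <;> simp only [treeLabel]
    · have := H.siblings_root i b
      omega
    · have h₁ := H.siblings i b c
      have h₂ := H.h_lt i 0 b
      have h₃ := H.h_lt i 1 b
      -- A parent edge in the first block needs the table condition; in later blocks its label
      -- exceeds `4n`, hence any difference within a block.
      rcases Nat.eq_zero_or_pos (heapIndex v) with hv | hv
      · rw [hv]
        omega
      · have h₄ : 4 * n ≤ 4 * n * heapIndex v := Nat.le_mul_of_pos_right _ hv
        generalize 4 * n * heapIndex v = x at *
        omega
  have l₀ := hlt 0
  have l₁ := hlt 1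
  have hpos := treeLabel_pos (g := g) (h := h) i b u
  apply distinctSubsetSums_three <;> simp <;> omega

theorem leaf_distinctSubsetSums (H : IsLabelTable g h) (a : Fin 2) (u : List (Fin 2)) :
    DistinctSubsetSums fun i => treeLabel g h i a u := by
  rcases u with - | ⟨b, u⟩
  · exact H.leaf_root a
  · exact H.leaf a b _ (by omega)

theorem isARGraph_gluedTree (H : IsLabelTable g h) {r : ℕ} (hr : 1 ≤ r) :
    IsARGraph (gluedTree n r 2) := by
  let E := Equiv.ofBijective _ (childEdge_bijective n r)
  let f : (gluedTree n r 2).edgeSet → ℕ := fun e =>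
    treeLabel g h (E.symm e).1 (E.symm e).2.1 (E.symm e).2.2.1
  have hf : ∀ x, f (childEdge x) = treeLabel g h x.1 x.2.1 x.2.2.1 := by
    intro x
    have : E.symm (childEdge x) = x := E.symm_apply_apply x
    simp only [f, this]
  refine ⟨f, ⟨?_, fun e => treeLabel_pos _ _ _, ?_⟩, fun e => ⟨treeLabel_pos _ _ _,
    (H.treeLabel_le _ _ (E.symm e).2.2.2).trans (le_ncard_edgeSet_gluedTree n r)⟩⟩
  · intro e e' he
    obtain ⟨h₁, h₂, h₃⟩ := H.treeLabel_inj he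
    exact E.symm.injective (Prod.ext h₁ (Prod.ext h₂ (Subtype.ext h₃)))
  · rintro (⟨i, w, hw⟩ | ⟨w, hw⟩)
    · rcases w with - | ⟨b, u⟩
      · refine isARVertex_of_distinctSubsetSums (fun a => childEdge ⟨i, a, [], hw⟩) ?_ ?_
        · intro e he
          obtain ⟨⟨j, a, v⟩, rfl⟩ := (childEdge_bijective n r).2 e
          obtain ⟨rfl, h₁ | h₁⟩ := inl_mem_childEdge he
          · simp only at h₁
            exact ⟨a, by rw [h₁]⟩
          · simp at h₁
        · simpa only [hf] using H.siblings_root_distinctSubsetSums i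
      · have hu : u.length < r := (Nat.lt_succ_self _).trans hw
        refine isARVertex_of_distinctSubsetSums ![childEdge ⟨i, 0, b :: u, hw⟩,
          childEdge ⟨i, 1, b :: u, hw⟩, childEdge ⟨i, b, u, hu⟩] ?_ ?_
        · intro e he
          obtain ⟨⟨j, a, v⟩, rfl⟩ := (childEdge_bijective n r).2 e
          obtain ⟨rfl, h₁ | h₁⟩ := inl_mem_childEdge he
          · simp only at h₁
            subst h₁
            fin_cases a
            exacts [⟨0, rfl⟩, ⟨1, rfl⟩]
          · obtain ⟨v, hv⟩ := v
            simp only [List.cons.injEq] at h₁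
            obtain ⟨rfl, rfl⟩ := h₁
            exact ⟨2, rfl⟩
        · convert H.inner_distinctSubsetSums i b u using 1
          funext k
          fin_cases k <;> simp [hf]
    · rcases w with - | ⟨b, u⟩
      · simp only [List.length_nil] at hw
        omega
      · have hu : u.length < r := by
          rw [← hw]
          exact Nat.lt_succ_self _
        refine isARVertex_of_distinctSubsetSums (fun i => childEdge ⟨i, b, u, hu⟩) ?_ ?_
        · intro e he
          obtain ⟨⟨j, a, v, hv⟩, rfl⟩ := (childEdge_bijective n r).2 e
          have h₁ := inr_mem_childEdge he
          simp only [List.cons.injEq] at h₁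
          obtain ⟨rfl, rfl⟩ := h₁
          exact ⟨j, rfl⟩
        · simpa only [hf] using H.leaf_distinctSubsetSums b u

end IsLabelTable

/-! ### Tables for one to four copies -/

/-- The pattern `2n * b + …` of the other tables fails here: siblings would differ by 1, which is
also the label of a root edge. -/
theorem isLabelTable_one : IsLabelTable (n := 1) (fun _ b => b)
    (fun _ => ![![3, 1], ![0, 2]]) where
  g_lt := by decide
  h_lt := by decide
  g_inj := by decide
  h_inj := by decide
  siblings_root := by decide
  siblings := by decide
  leaf_root a := distinctSubsetSums_one (by omega)
  leaf a b k hk := distinctSubsetSums_one (by omega)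

theorem isLabelTable_two : IsLabelTable ![![0, 1], ![2, 3]]
    (fun i a b => 4 * b + ![![0, 3], ![1, 2]] i a) where
  g_lt := by decide
  h_lt := by decide
  g_inj := by decide
  h_inj := by decide
  siblings_root := by decide
  siblings := by decide
  leaf_root a := by
    apply distinctSubsetSums_two <;> fin_cases a <;> decide
  leaf a b k hk := by
    apply distinctSubsetSums_two <;> fin_cases a <;> simp <;> omega

theorem isLabelTable_three : IsLabelTable ![![0, 4], ![1, 2], ![3, 5]]
    (fun i a b => 6 * b + ![![0, 3], ![1, 2], ![4, 5]] i a) where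
  g_lt := by decide
  h_lt := by decide
  g_inj := by decide
  h_inj := by decide
  siblings_root := by decide
  siblings := by decide
  leaf_root a := by
    apply distinctSubsetSums_three <;> fin_cases a <;> decide
  leaf a b k hk := by
    apply distinctSubsetSums_three <;> fin_cases a <;> simp <;> omega

/-- The columns `0, 1, 2, 4` and `7, 6, 3, 5` of the lower table have odd totals, so four labels at
a quasi-leaf never split into two pairs of equal sum. -/
theorem isLabelTable_four : IsLabelTable ![![0, 2], ![1, 5], ![3, 4], ![7, 6]]
    (fun i a b => 8 * b + ![![0, 7], ![1, 6], ![2, 3], ![4, 5]] i a) where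
  g_lt := by decide
  h_lt := by decide
  g_inj := by decide
  h_inj := by decide
  siblings_root := by decide
  siblings := by decide
  leaf_root a := by
    -- The label sets are `{1, 2, 4, 8}` and `{3, 5, 6, 7}`.
    rw [distinctSubsetSums_iff_bits]
    revert a
    decide +kernel
  leaf a b k hk := by
    have hlt : ∀ (i : Fin 4) (a : Fin 2),
        (![![0, 7], ![1, 6], ![2, 3], ![4, 5]] : Fin 4 → Fin 2 → ℕ) i a < 8 := by decide
    have hinj : ∀ (a : Fin 2) (i j : Fin 4),
        (![![0, 7], ![1, 6], ![2, 3], ![4, 5]] : Fin 4 → Fin 2 → ℕ) i a =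
        (![![0, 7], ![1, 6], ![2, 3], ![4, 5]] : Fin 4 → Fin 2 → ℕ) j a → i = j := by decide
    apply distinctSubsetSums_four
    · intro i j l
      have := hlt i a
      omega
    · intro i j hij
      exact hinj a i j (by dsimp only at hij; omega)
    all_goals fin_cases a <;> simp <;> omega

theorem theorem6 (r n : ℕ) (hr : 1 ≤ r) (hn₁ : 1 ≤ n) (hn₄ : n ≤ 4) :
    IsARGraph (gluedTree n r 2) := by
  interval_cases n
  exacts [isLabelTable_one.isARGraph_gluedTree hr, isLabelTable_two.isARGraph_gluedTree hr,
    isLabelTable_three.isARGraph_gluedTree hr, isLabelTable_four.isARGraph_gluedTree hr]
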